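/- Let $A\in\mathbb R^{m\times n}$ have full row rank, with columns $A_1,\dots,A_n$. For $\lambda\ge 0$ and $b\in\mathbb R^m$ let $S(\lambda,b)\subset\mathbb R^n$ be the set of minimizers of $\|x\|_1+\frac1{2\lambda}\|Ax-b\|^2$ over $x\in\mathbb R^n$ if $\lambda>0$, and the set of minimizers of $\|x\|_1$ subject to $Ax=b$ if $\lambda=0$. Let $Y^0=\{y\in\mathbb R^m:\|A^\top y\|_\infty\le 1\}$ and let $\mathcal F$ be the collection of nonempty faces of $Y^0$, i.e. of all nonempty sets $F=\operatorname{argmax}\{v^\top y: y\in Y^0\}$ with $v\in\mathbb R^m$. For $F\in\mathcal F$ put $$\mathcal A^{\pm}(F)=\{i: A_i^\top y=\pm1\ \forall y\in F\},\qquad \mathcal A^0(F)=\{i: -1<A_i^\top y<1\text{ for some }y\in F\},$$ and let $D_F$ be the set of all $(\lambda,b)\in\mathbb R_+\times\mathbb R^m$ for which there is $x\in\mathbb R^n$ with $$\begin{array}{ll} x_i\ge 0,\ A_i^\top(b-Ax)=\lambda & (i\in\mathcal A^+(F)),\\ x_i=0,\ -\lambda\le A_i^\top(b-Ax)\le\lambda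 & (i\in\mathcal A^0(F)),\\ x_i\le 0,\ A_i^\top(b-Ax)=-\lambda & (i\in\mathcal A^-(F)).\end{array}$$ Say that $S$ is single-valued and linear on $D\subset\mathbb R\times\mathbb R^m$ if there is a linear map $L:\mathbb R\times\mathbb R^m\to\mathbb R^n$ with $S(\lambda,b)=\{L(\lambda,b)\}$ for all $(\lambda,b)\in D$. Let $\bar\lambda>0$ and $\bar b\in\mathbb R^m$. Then: (i) $S$ is single-valued and linear on every $D_F$, $F\in\mathcal F$, that contains $(\bar\lambda,\bar b)$ if and only if (Tibshirani's condition) there is $\bar x\in S(\bar\lambda,\bar b)$ such that the columns $A_i$ with $|A_i^\top(\bar b-A\bar x)|=\bar\lambda$ are linearly independent. (ii) There is at most one $F\in\mathcal F$ such that $(\bar\lambda,\bar b)$ is an interior point of $D_F$; and such an $F$ exists and $S$ is single-valued and linear on this $D_F$ if and only if (Fuchs' condition) there is $\bar x\in S(\bar\lambda,\bar b)$ such that the columns $A_i$ with $\bar x_i\ne0$ are linearly independent and $|A_i^\top(\bar b-A\bar x)|<\bar\lambda$ for all $i$ with $\bar x_i=0$. -/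

import Mathlib

open scoped Matrix

namespace ExtendedLasso

noncomputable section

/-- The `ℓ¹`-norm on `ℝⁿ`. -/
def l1norm {n : ℕ} (x : Fin n → ℝ) : ℝ := ∑ i, |x i|

/-- The squared Euclidean norm on `ℝᵐ`. -/
def sqNorm {m : ℕ} (r : Fin m → ℝ) : ℝ := ∑ k, r k ^ 2

/-- Optimal solutions of basis pursuit: minimise `‖x‖₁` subject to `A x = b`. -/
def basisPursuitSol {m n : ℕ} (A : Matrix (Fin m) (Fin n) ℝ) (b : Fin m → ℝ) :
    Set (Fin n → ℝ) :=
  {x | A *ᵥ x = b ∧ ∀ z : Fin n → ℝ, A *ᵥ z = b → l1norm x ≤ l1norm z}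

/-- Optimal solutions of the Lasso: minimise `‖x‖₁ + (1 / (2 lam)) ‖A x - b‖²` over `ℝⁿ`. -/
def lassoSol {m n : ℕ} (A : Matrix (Fin m) (Fin n) ℝ) (lam : ℝ) (b : Fin m → ℝ) :
    Set (Fin n → ℝ) :=
  {x | ∀ z : Fin n → ℝ,
    l1norm x + 1 / (2 * lam) * sqNorm (A *ᵥ x - b) ≤
      l1norm z + 1 / (2 * lam) * sqNorm (A *ᵥ z - b)}

/-- The optimal solution multifunction `S` of the extended `ℓ¹` regularization problem, at
`p = (lam, b)`: the Lasso solutions for `lam > 0`, the basis pursuit solutions for `lam = 0`;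
the parameter set is `ℝ₊ × ℝᵐ`, so `S` has no values for `lam < 0`. -/
def S {m n : ℕ} (A : Matrix (Fin m) (Fin n) ℝ) (p : ℝ × (Fin m → ℝ)) : Set (Fin n → ℝ) :=
  {x | (0 < p.1 ∧ x ∈ lassoSol A p.1 p.2) ∨ (p.1 = 0 ∧ x ∈ basisPursuitSol A p.2)}

/-- The dual feasible set `Y⁰ = {y | ‖Aᵀ y‖_∞ ≤ 1}`; the norm of `Fin n → ℝ` is the sup norm. -/
def Y0 {m n : ℕ} (A : Matrix (Fin m) (Fin n) ℝ) : Set (Fin m → ℝ) :=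
  {y | ‖Aᵀ *ᵥ y‖ ≤ 1}

/-- The collection of all nonempty faces of `Y⁰`, a face being the set of maximisers over `Y⁰` of
some linear functional (possibly zero). -/
def faces {m n : ℕ} (A : Matrix (Fin m) (Fin n) ℝ) : Set (Set (Fin m → ℝ)) :=
  {F | F.Nonempty ∧ IsExposed ℝ (Y0 A) F}

/-- The indices `i` with `Aᵢᵀ y = 1` for all `y ∈ F`. -/
def activePos {m n : ℕ} (A : Matrix (Fin m) (Fin n) ℝ) (F : Set (Fin m → ℝ)) : Set (Fin n) :=
  {i | ∀ y ∈ F, A.col i ⬝ᵥ y = 1}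

/-- The indices `i` with `Aᵢᵀ y = -1` for all `y ∈ F`. -/
def activeNeg {m n : ℕ} (A : Matrix (Fin m) (Fin n) ℝ) (F : Set (Fin m → ℝ)) : Set (Fin n) :=
  {i | ∀ y ∈ F, A.col i ⬝ᵥ y = -1}

/-- The indices `i` with `-1 < Aᵢᵀ y < 1` for some `y ∈ F`. -/
def activeZero {m n : ℕ} (A : Matrix (Fin m) (Fin n) ℝ) (F : Set (Fin m → ℝ)) : Set (Fin n) :=
  {i | ∃ y ∈ F, -1 < A.col i ⬝ᵥ y ∧ A.col i ⬝ᵥ y < 1}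

/-- The polyhedral cone `S_F` of triples `(lam, b, x)`. -/
def SF {m n : ℕ} (A : Matrix (Fin m) (Fin n) ℝ) (F : Set (Fin m → ℝ)) :
    Set (ℝ × (Fin m → ℝ) × (Fin n → ℝ)) :=
  {q | 0 ≤ q.1 ∧
    (∀ i ∈ activePos A F, 0 ≤ q.2.2 i ∧ A.col i ⬝ᵥ (q.2.1 - A *ᵥ q.2.2) = q.1) ∧
    (∀ i ∈ activeZero A F, q.2.2 i = 0 ∧
      -q.1 ≤ A.col i ⬝ᵥ (q.2.1 - A *ᵥ q.2.2) ∧ A.col i ⬝ᵥ (q.2.1 - A *ᵥ q.2.2) ≤ q.1) ∧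
    (∀ i ∈ activeNeg A F, q.2.2 i ≤ 0 ∧ A.col i ⬝ᵥ (q.2.1 - A *ᵥ q.2.2) = -q.1)}

/-- The projection `D_F` of `S_F` to the parameters `(lam, b)`. -/
def DF {m n : ℕ} (A : Matrix (Fin m) (Fin n) ℝ) (F : Set (Fin m → ℝ)) :
    Set (ℝ × (Fin m → ℝ)) :=
  (fun q : ℝ × (Fin m → ℝ) × (Fin n → ℝ) => (q.1, q.2.1)) '' SF A F

/-- The multifunction `G` is single-valued and linear on `D`: its restriction to `D` is the
restriction to `D` of a linear map. -/
def SingleValuedLinearOn {m n : ℕ} (G : ℝ × (Fin m → ℝ) → Set (Fin n → ℝ))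
    (D : Set (ℝ × (Fin m → ℝ))) : Prop :=
  ∃ L : (ℝ × (Fin m → ℝ)) →ₗ[ℝ] (Fin n → ℝ), ∀ p ∈ D, G p = {L p}

/-- The index set `J(lam, b, x) = {i | |Aᵢᵀ (b - A x)| = lam}`. -/
def J {m n : ℕ} (A : Matrix (Fin m) (Fin n) ℝ) (lam : ℝ) (b : Fin m → ℝ) (x : Fin n → ℝ) :
    Set (Fin n) :=
  {i | |A.col i ⬝ᵥ (b - A *ᵥ x)| = lam}

/-- Tibshirani's condition at `(lam, b)`. -/
def TibshiraniCondition {m n : ℕ} (A : Matrix (Fin m) (Fin n) ℝ) (lam : ℝ) (b : Fin m → ℝ) :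
    Prop :=
  ∃ x ∈ S A (lam, b), LinearIndepOn ℝ A.col (J A lam b x)

/-- Fuchs' condition at `(lam, b)`. -/
def FuchsCondition {m n : ℕ} (A : Matrix (Fin m) (Fin n) ℝ) (lam : ℝ) (b : Fin m → ℝ) : Prop :=
  ∃ x ∈ S A (lam, b), LinearIndepOn ℝ A.col {i | 0 < x i ∨ x i < 0} ∧
    ∀ i, x i = 0 → |A.col i ⬝ᵥ (b - A *ᵥ x)| < lam

end

end ExtendedLasso

/-! Write `y = (b - A x) / lam`. For `lam > 0`, `x` is a Lasso solution exactly when `y ∈ Y⁰` and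
`(A x) ⬝ y = ‖x‖₁`. Equality in this duality says that `x` is sign-compatible with any face `F`
containing `y`. Hence over `D_F` the solution set is the slice of `S_F`: sign-compatible `x` with `y
∈ F` (`S_eq_slice`).

If `D_F` contains a point with `lam > 0`, then `S` is single-valued and linear on `D_F` iff the
columns active on `F` are independent. Independence makes the equations of `S_F` uniquely and
linearly solvable. Conversely, a dependency among active columns yields two solutions once `x` is
pushed far enough into its sign cone. For (i), all solutions share `y`, and among the faces
containing `y` the smallest has the largest active set, namely `J`.

For (ii), shifts of `b` inside the span of the active columns move only `A x`, and shifts orthogonal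
to it move only `y` (`orthogonal_perturbation`). An interior point of `D_F` therefore has `y` in the
relative interior of `F`, which determines `F`; under independence it also has every active `x i`
nonzero. Conversely, these strict inequalities persist near `(lam, b)` because the solution map is
continuous. -/

namespace ExtendedLasso

variable {m n : ℕ} {A : Matrix (Fin m) (Fin n) ℝ}

/-! ### Duality between the `ℓ¹`-norm and `Y⁰` -/

lemma mulVec_dotProduct_eq_sum (x : Fin n → ℝ) (y : Fin m → ℝ) :
    (A *ᵥ x) ⬝ᵥ y = ∑ i, x i * (A.col i ⬝ᵥ y) := by
  rw [dotProduct_comm, Matrix.dotProduct_mulVec, dotProduct_comm]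
  simp only [dotProduct, Matrix.vecMul, Matrix.col_apply, mul_comm]

lemma mem_Y0_iff (y : Fin m → ℝ) : y ∈ Y0 A ↔ ∀ i, |A.col i ⬝ᵥ y| ≤ 1 :=
  pi_norm_le_iff_of_nonneg zero_le_one

lemma convex_Y0 : Convex ℝ (Y0 A) := by
  intro y hy z hz s t hs ht hst
  rw [mem_Y0_iff] at *
  intro i
  rw [dotProduct_add, dotProduct_smul, dotProduct_smul, smul_eq_mul, smul_eq_mul]
  obtain ⟨h1, h2⟩ := abs_le.1 (hy i)
  obtain ⟨h3, h4⟩ := abs_le.1 (hz i)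
  rw [abs_le]
  constructor <;> nlinarith

lemma sqNorm_eq_dotProduct (r : Fin m → ℝ) : sqNorm r = r ⬝ᵥ r := by
  simp [sqNorm, dotProduct, sq]

lemma sqNorm_nonneg (r : Fin m → ℝ) : 0 ≤ sqNorm r :=
  Finset.sum_nonneg fun _ _ => sq_nonneg _

lemma eq_zero_of_sqNorm {r : Fin m → ℝ} (h : sqNorm r = 0) : r = 0 := by
  rwa [sqNorm_eq_dotProduct, dotProduct_self_eq_zero] at h

lemma mul_le_abs_of_mem_Y0 {y : Fin m → ℝ} (hy : y ∈ Y0 A) (x : Fin n → ℝ) (i : Fin n) :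
    x i * (A.col i ⬝ᵥ y) ≤ |x i| := by
  refine (le_abs_self _).trans ?_
  rw [abs_mul]
  exact mul_le_of_le_one_right (abs_nonneg _) ((mem_Y0_iff y).1 hy i)

lemma mulVec_dotProduct_le {y : Fin m → ℝ} (hy : y ∈ Y0 A) (x : Fin n → ℝ) :
    (A *ᵥ x) ⬝ᵥ y ≤ l1norm x := by
  rw [mulVec_dotProduct_eq_sum]
  exact Finset.sum_le_sum fun i _ => mul_le_abs_of_mem_Y0 hy x i

/-- Complementary slackness: equality between the sums forces equality in each of the termwise
bounds. -/
lemma mul_eq_abs_of_dotProduct_eq {y : Fin m → ℝ} (hy : y ∈ Y0 A) {x : Fin n → ℝ}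
    (h : (A *ᵥ x) ⬝ᵥ y = l1norm x) (i : Fin n) : x i * (A.col i ⬝ᵥ y) = |x i| := by
  rw [mulVec_dotProduct_eq_sum] at h
  exact (Finset.sum_eq_sum_iff_of_le fun i _ => mul_le_abs_of_mem_Y0 hy x i).1 h i
    (Finset.mem_univ i)

/-- The exact difference between two Lasso objective values. -/
lemma lasso_objective_eq {lam : ℝ} (hlam : 0 < lam) {b y : Fin m → ℝ} {x : Fin n → ℝ}
    (hy : b - A *ᵥ x = lam • y) (z : Fin n → ℝ) :
    l1norm z + 1 / (2 * lam) * sqNorm (A *ᵥ z - b) =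
      l1norm x + 1 / (2 * lam) * sqNorm (A *ᵥ x - b) +
        ((l1norm z - (A *ᵥ z) ⬝ᵥ y) - (l1norm x - (A *ᵥ x) ⬝ᵥ y)) +
        1 / (2 * lam) * sqNorm (A *ᵥ z - A *ᵥ x) := by
  have hb : b = lam • y + A *ᵥ x := by rw [← hy]; abel
  have h1 : A *ᵥ z - b = (A *ᵥ z - A *ᵥ x) - lam • y := by rw [hb]; abel
  have h2 : A *ᵥ x - b = -(lam • y) := by rw [hb]; abel
  rw [h1, h2]
  simp only [sqNorm_eq_dotProduct, dotProduct_sub, sub_dotProduct, dotProduct_smul, smul_dotProduct,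
    neg_dotProduct, dotProduct_neg, smul_eq_mul, dotProduct_comm y]
  field_simp
  ring

/-! ### Faces of the dual feasible set -/

section Face

variable {F : Set (Fin m → ℝ)}

lemma face_subset_Y0 (hF : F ∈ faces A) : F ⊆ Y0 A := hF.2.subset

lemma convex_face (hF : F ∈ faces A) : Convex ℝ F := hF.2.convex convex_Y0

/-- A relative interior point of `F`: the midpoint of a strict and a feasible value is strict, so
witnesses for the single indices can be averaged one after another. -/
lemma exists_strict_point (hF : F ∈ faces A) :
    ∃ y ∈ F, ∀ i ∈ activeZero A F, |A.col i ⬝ᵥ y| < 1 := by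
  have key : ∀ s : Finset (Fin n),
      ∃ y ∈ F, ∀ i ∈ s, i ∈ activeZero A F → |A.col i ⬝ᵥ y| < 1 := by
    intro s
    induction s using Finset.induction_on with
    | empty => exact ⟨hF.1.some, hF.1.some_mem, by simp⟩
    | insert j s _ ih =>
      obtain ⟨y, hy, hys⟩ := ih
      by_cases hj : j ∈ activeZero A F
      · obtain ⟨z, hz, hz1, hz2⟩ := hj
        refine ⟨(1 / 2 : ℝ) • y + (1 / 2 : ℝ) • z,
          convex_face hF hy hz (by norm_num) (by norm_num) (by norm_num), ?_⟩
        intro i hi hi0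
        have hyi := abs_le.1 ((mem_Y0_iff y).1 (face_subset_Y0 hF hy) i)
        have hzi := abs_le.1 ((mem_Y0_iff z).1 (face_subset_Y0 hF hz) i)
        rw [dotProduct_add, dotProduct_smul, dotProduct_smul, smul_eq_mul, smul_eq_mul, abs_lt]
        rcases Finset.mem_insert.1 hi with rfl | his
        · constructor <;> linarith
        · have := abs_lt.1 (hys i his hi0)
          constructor <;> linarith
      · refine ⟨y, hy, fun i hi hi0 => ?_⟩
        rcases Finset.mem_insert.1 hi with rfl | his
        · exact absurd hi0 hj
        · exact hys i his hi0
  obtain ⟨y, hy, h⟩ := key Finset.univ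
  exact ⟨y, hy, fun i hi => h i (Finset.mem_univ i) hi⟩

/-- If a column took both values `1` and `-1` on `F`, the midpoint would give `0`, by convexity. -/
lemma active_trichotomy (hF : F ∈ faces A) (i : Fin n) :
    i ∈ activePos A F ∨ i ∈ activeNeg A F ∨ i ∈ activeZero A F := by
  by_contra! h
  obtain ⟨h1, h2, h3⟩ := h
  simp only [activePos, activeNeg, activeZero, Set.mem_ofPred_eq, not_forall, not_exists,
    not_and] at h1 h2 h3
  obtain ⟨y, hy, hy1⟩ := h1
  obtain ⟨z, hz, hz1⟩ := h2
  have hyi := abs_le.1 ((mem_Y0_iff y).1 (face_subset_Y0 hF hy) i)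
  have hzi := abs_le.1 ((mem_Y0_iff z).1 (face_subset_Y0 hF hz) i)
  have hy2 : A.col i ⬝ᵥ y = -1 := by
    by_contra hne
    exact h3 y hy (lt_of_le_of_ne hyi.1 (Ne.symm hne)) (lt_of_le_of_ne hyi.2 hy1)
  have hz2 : A.col i ⬝ᵥ z = 1 := by
    by_contra hne
    exact h3 z hz (lt_of_le_of_ne hzi.1 (Ne.symm hz1)) (lt_of_le_of_ne hzi.2 hne)
  have hw := convex_face hF hy hz (a := 1 / 2) (b := 1 / 2) (by norm_num) (by norm_num)
    (by norm_num)
  refine h3 _ hw ?_ ?_ <;>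
  · rw [dotProduct_add, dotProduct_smul, dotProduct_smul, hy2, hz2]; norm_num

/-- The segment from `y` to a relative interior point `y₀` can be prolonged a little beyond `y₀`
within `Y⁰`. The functional exposing `F` is maximal at `y₀`, so it does not increase along the
prolongation, whence its value at `y` is at least that at `y₀`. -/
lemma mem_face_of_active (hF : F ∈ faces A) {y : Fin m → ℝ} (hy : y ∈ Y0 A)
    (hpos : ∀ i ∈ activePos A F, A.col i ⬝ᵥ y = 1)
    (hneg : ∀ i ∈ activeNeg A F, A.col i ⬝ᵥ y = -1) : y ∈ F := by
  obtain ⟨y₀, hy₀, hstrict⟩ := exists_strict_point hF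
  obtain ⟨l, hl⟩ := hF.2 hF.1
  have hev : ∀ i, ∀ᶠ t : ℝ in nhdsWithin 0 (Set.Ioi 0),
      |A.col i ⬝ᵥ (y₀ - t • (y - y₀))| ≤ 1 := by
    intro i
    rcases active_trichotomy hF i with hi | hi | hi
    · refine Filter.Eventually.of_forall fun t => ?_
      rw [dotProduct_sub, dotProduct_smul, dotProduct_sub, hpos i hi, hi y₀ hy₀]; simp
    · refine Filter.Eventually.of_forall fun t => ?_
      rw [dotProduct_sub, dotProduct_smul, dotProduct_sub, hneg i hi, hi y₀ hy₀]; simp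
    · refine Filter.Eventually.filter_mono nhdsWithin_le_nhds ?_
      have hc : Continuous fun t : ℝ => |A.col i ⬝ᵥ (y₀ - t • (y - y₀))| := by
        simp only [dotProduct_sub, dotProduct_smul, smul_eq_mul]
        fun_prop
      filter_upwards [hc.continuousAt.eventually_lt (g := fun _ => 1) continuousAt_const
        (by simpa using hstrict i hi)] with t ht using ht.le
  obtain ⟨t, ht, ht0⟩ := ((Filter.eventually_all.2 hev).and self_mem_nhdsWithin).exists
  rw [hl] at hy₀ ⊢
  have h1 := hy₀.2 _ ((mem_Y0_iff _).2 ht)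
  rw [map_sub, map_smul, map_sub, smul_eq_mul] at h1
  have h2 : 0 ≤ t * (l y - l y₀) := by linarith
  have h3 := nonneg_of_mul_nonneg_right h2 ht0
  exact ⟨hy, fun z hz => (hy₀.2 z hz).trans (by linarith)⟩

lemma face_eq_of_active_eq {F' : Set (Fin m → ℝ)} (hF : F ∈ faces A) (hF' : F' ∈ faces A)
    (hpos : activePos A F = activePos A F') (hneg : activeNeg A F = activeNeg A F') : F = F' := by
  apply Set.Subset.antisymm
  · intro y hy
    refine mem_face_of_active hF' (face_subset_Y0 hF hy) ?_ ?_
    · rw [← hpos]; exact fun i hi => hi y hy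
    · rw [← hneg]; exact fun i hi => hi y hy
  · intro y hy
    refine mem_face_of_active hF (face_subset_Y0 hF' hy) ?_ ?_
    · rw [hpos]; exact fun i hi => hi y hy
    · rw [hneg]; exact fun i hi => hi y hy

/-- The smallest face through a point of `Y⁰`. -/
lemma exists_minimal_face {y : Fin m → ℝ} (hy : y ∈ Y0 A) :
    ∃ F ∈ faces A, y ∈ F ∧ activePos A F = {i | A.col i ⬝ᵥ y = 1} ∧
      activeNeg A F = {i | A.col i ⬝ᵥ y = -1} ∧
      activeZero A F = {i | |A.col i ⬝ᵥ y| < 1} := by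
  classical
  -- The signs of the constraints saturated at `y`: the functional `A *ᵥ s` attains its bound
  -- `l1norm s` on `Y⁰` only where all these constraints are saturated.
  let s : Fin n → ℝ := fun i =>
    if A.col i ⬝ᵥ y = 1 then 1 else if A.col i ⬝ᵥ y = -1 then -1 else 0
  have hs1 : ∀ i, A.col i ⬝ᵥ y = 1 → s i = 1 := fun i hi => if_pos hi
  have hs2 : ∀ i, A.col i ⬝ᵥ y = -1 → s i = -1 := by
    intro i hi
    simp only [s]
    rw [if_neg (by rw [hi]; norm_num), if_pos hi]
  have hs3 : ∀ i, A.col i ⬝ᵥ y ≠ 1 → A.col i ⬝ᵥ y ≠ -1 → s i = 0 := by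
    intro i h1 h2
    simp only [s]
    rw [if_neg h1, if_neg h2]
  have hys : (A *ᵥ s) ⬝ᵥ y = l1norm s := by
    rw [mulVec_dotProduct_eq_sum]
    refine Finset.sum_congr rfl fun i _ => ?_
    by_cases h1 : A.col i ⬝ᵥ y = 1
    · rw [hs1 i h1, h1]; norm_num
    · by_cases h2 : A.col i ⬝ᵥ y = -1
      · rw [hs2 i h2, h2]; norm_num
      · rw [hs3 i h1 h2]; norm_num
  let l : (Fin m → ℝ) →L[ℝ] ℝ := LinearMap.toContinuousLinearMap (dotProductBilin ℝ ℝ (A *ᵥ s))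
  have hl : ∀ z, l z = (A *ᵥ s) ⬝ᵥ z := fun z => rfl
  let F : Set (Fin m → ℝ) := {z ∈ Y0 A | ∀ w ∈ Y0 A, l w ≤ l z}
  have hyF : y ∈ F := ⟨hy, fun w hw => by rw [hl, hl, hys]; exact mulVec_dotProduct_le hw s⟩
  have hF : F ∈ faces A := ⟨⟨y, hyF⟩, fun _ => ⟨l, rfl⟩⟩
  have hz : ∀ z ∈ F, (A *ᵥ s) ⬝ᵥ z = l1norm s := fun z hz =>
    le_antisymm (mulVec_dotProduct_le hz.1 s) (by rw [← hys, ← hl, ← hl]; exact hz.2 y hy)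
  have hp : activePos A F = {i | A.col i ⬝ᵥ y = 1} := by
    ext i
    refine ⟨fun hi => hi y hyF, fun hi z hzF => ?_⟩
    have := mul_eq_abs_of_dotProduct_eq hzF.1 (hz z hzF) i
    rw [hs1 i hi] at this
    simpa using this
  have hn : activeNeg A F = {i | A.col i ⬝ᵥ y = -1} := by
    ext i
    refine ⟨fun hi => hi y hyF, fun hi z hzF => ?_⟩
    have := mul_eq_abs_of_dotProduct_eq hzF.1 (hz z hzF) i
    rw [hs2 i hi] at this
    norm_num at this
    linarith
  refine ⟨F, hF, hyF, hp, hn, ?_⟩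
  ext i
  constructor
  · rintro ⟨z, hzF, h1, h2⟩
    rw [Set.mem_ofPred_eq, abs_lt]
    obtain ⟨h3, h4⟩ := abs_le.1 ((mem_Y0_iff y).1 hy i)
    refine ⟨lt_of_le_of_ne h3 fun h => ?_, lt_of_le_of_ne h4 fun h => ?_⟩
    · have : i ∈ activeNeg A F := by rw [hn]; exact h.symm
      exact h1.ne (this z hzF).symm
    · have : i ∈ activePos A F := by rw [hp]; exact h
      exact h2.ne (this z hzF)
  · intro hi
    exact ⟨y, hyF, (abs_lt.1 hi).1, (abs_lt.1 hi).2⟩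

/-! ### The slices of `S_F` -/

/-- The sign pattern of `x` is compatible with the face `F`. -/
def SignCompatible (A : Matrix (Fin m) (Fin n) ℝ) (F : Set (Fin m → ℝ)) (x : Fin n → ℝ) : Prop :=
  (∀ i ∈ activePos A F, 0 ≤ x i) ∧ (∀ i ∈ activeZero A F, x i = 0) ∧
    ∀ i ∈ activeNeg A F, x i ≤ 0

lemma SignCompatible.dotProduct_eq (hF : F ∈ faces A) {x : Fin n → ℝ}
    (hx : SignCompatible A F x) {y : Fin m → ℝ} (hy : y ∈ F) : (A *ᵥ x) ⬝ᵥ y = l1norm x := by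
  rw [mulVec_dotProduct_eq_sum]
  refine Finset.sum_congr rfl fun i _ => ?_
  rcases active_trichotomy hF i with hi | hi | hi
  · rw [hi y hy, abs_of_nonneg (hx.1 i hi), mul_one]
  · rw [hi y hy, abs_of_nonpos (hx.2.2 i hi), mul_neg_one]
  · simp [hx.2.1 i hi]

/-- Slackness at a relative interior point of `F` fixes the signs on active columns and kills `x i`
on the others. -/
lemma signCompatible_of_dotProduct_eq (hF : F ∈ faces A) {x : Fin n → ℝ}
    (h : ∀ y ∈ F, (A *ᵥ x) ⬝ᵥ y = l1norm x) : SignCompatible A F x := by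
  obtain ⟨y, hy, hstrict⟩ := exists_strict_point hF
  have key := mul_eq_abs_of_dotProduct_eq (face_subset_Y0 hF hy) (h y hy)
  refine ⟨fun i hi => ?_, fun i hi => ?_, fun i hi => ?_⟩
  · have := key i
    rw [hi y hy, mul_one] at this
    exact abs_eq_self.1 this.symm
  · by_contra hne
    have h1 := abs_pos.2 hne
    have h2 := congrArg abs (key i)
    rw [abs_mul, abs_abs] at h2
    nlinarith [hstrict i hi]
  · have := key i
    rw [hi y hy, mul_neg_one] at this
    exact abs_eq_neg_self.1 this.symm

lemma mem_SF_iff_of_pos (hF : F ∈ faces A) {lam : ℝ} (hlam : 0 < lam) {b y : Fin m → ℝ}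
    {x : Fin n → ℝ} (hy : b - A *ᵥ x = lam • y) :
    (lam, b, x) ∈ SF A F ↔ SignCompatible A F x ∧ y ∈ F := by
  simp only [SF, Set.mem_ofPred_eq, hy, dotProduct_smul, smul_eq_mul]
  constructor
  · rintro ⟨-, hp, hz, hn⟩
    have hp' : ∀ i ∈ activePos A F, A.col i ⬝ᵥ y = 1 := fun i hi => by
      have := (hp i hi).2
      exact mul_left_cancel₀ hlam.ne' (this.trans (mul_one lam).symm)
    have hn' : ∀ i ∈ activeNeg A F, A.col i ⬝ᵥ y = -1 := fun i hi => by
      have := (hn i hi).2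
      exact mul_left_cancel₀ hlam.ne' (this.trans (mul_neg_one lam).symm)
    refine ⟨⟨fun i hi => (hp i hi).1, fun i hi => (hz i hi).1, fun i hi => (hn i hi).1⟩,
      mem_face_of_active hF ((mem_Y0_iff y).2 fun i => ?_) hp' hn'⟩
    rcases active_trichotomy hF i with hi | hi | hi
    · simp [hp' i hi]
    · simp [hn' i hi]
    · obtain ⟨-, h1, h2⟩ := hz i hi
      rw [abs_le]
      constructor <;> nlinarith
  · rintro ⟨hx, hyF⟩
    refine ⟨hlam.le, fun i hi => ⟨hx.1 i hi, by rw [hi y hyF, mul_one]⟩,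
      fun i hi => ⟨hx.2.1 i hi, ?_⟩, fun i hi => ⟨hx.2.2 i hi, by rw [hi y hyF, mul_neg_one]⟩⟩
    have := abs_le.1 ((mem_Y0_iff y).1 (face_subset_Y0 hF hyF) i)
    constructor <;> nlinarith

/-- Full row rank makes the columns span. This is needed at `lam = 0`, where `S_F` only makes the
residual orthogonal to all columns. -/
lemma eq_zero_of_col_dotProduct_eq_zero (hA : A.rank = m) {w : Fin m → ℝ}
    (hw : ∀ i, A.col i ⬝ᵥ w = 0) : w = 0 := by
  have htop : LinearMap.range A.mulVecLin = ⊤ :=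
    Submodule.eq_top_of_finrank_eq (by simpa [Matrix.rank] using hA)
  obtain ⟨x, hx⟩ := LinearMap.range_eq_top.1 htop w
  rw [Matrix.mulVecLin_apply] at hx
  refine dotProduct_self_eq_zero.1 ?_
  nth_rewrite 1 [← hx]
  rw [mulVec_dotProduct_eq_sum]
  exact Finset.sum_eq_zero fun i _ => by rw [hw i, mul_zero]

lemma mem_SF_zero_iff (hA : A.rank = m) (hF : F ∈ faces A) {b : Fin m → ℝ} {x : Fin n → ℝ} :
    (0, b, x) ∈ SF A F ↔ SignCompatible A F x ∧ A *ᵥ x = b := by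
  simp only [SF, Set.mem_ofPred_eq, neg_zero]
  constructor
  · rintro ⟨-, hp, hz, hn⟩
    refine ⟨⟨fun i hi => (hp i hi).1, fun i hi => (hz i hi).1, fun i hi => (hn i hi).1⟩, ?_⟩
    refine (sub_eq_zero.1 (eq_zero_of_col_dotProduct_eq_zero hA fun i => ?_)).symm
    rcases active_trichotomy hF i with hi | hi | hi
    · exact (hp i hi).2
    · exact (hn i hi).2
    · exact le_antisymm (hz i hi).2.2 (hz i hi).2.1
  · rintro ⟨hx, rfl⟩
    simpa [SignCompatible] using hx

lemma exists_residual_eq {lam : ℝ} (hlam : 0 < lam) (b : Fin m → ℝ) (x : Fin n → ℝ) :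
    b - A *ᵥ x = lam • (lam⁻¹ • (b - A *ᵥ x)) := by
  rw [smul_smul, mul_inv_cancel₀ hlam.ne', one_smul]

/-- Over `D_F`, the solution set is the slice of `S_F`. -/
lemma S_eq_slice (hA : A.rank = m) (hF : F ∈ faces A) {p : ℝ × (Fin m → ℝ)} (hp : p ∈ DF A F) :
    S A p = {x | (p.1, p.2, x) ∈ SF A F} := by
  obtain ⟨⟨lam, b, x⟩, hx, rfl⟩ := hp
  have hnn : 0 ≤ lam := hx.1
  rcases hnn.eq_or_lt with rfl | hlam
  · have hbp : S A (0, b) = basisPursuitSol A b := by ext; simp [S]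
    obtain ⟨y, hy⟩ := hF.1
    rw [mem_SF_zero_iff hA hF] at hx
    change S A (0, b) = {z | (0, b, z) ∈ SF A F}
    rw [hbp]
    have hsuf : ∀ z, SignCompatible A F z → A *ᵥ z = b → z ∈ basisPursuitSol A b := by
      refine fun z hz hzb => ⟨hzb, fun w hw => ?_⟩
      rw [← hz.dotProduct_eq hF hy, hzb, ← hw]
      exact mulVec_dotProduct_le (face_subset_Y0 hF hy) w
    ext z
    rw [Set.mem_ofPred_eq, mem_SF_zero_iff hA hF]
    refine ⟨fun hz => ⟨signCompatible_of_dotProduct_eq hF fun w hw => ?_, hz.1⟩,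
      fun hz => hsuf z hz.1 hz.2⟩
    -- `z` and `x` have the same image and the same norm, so each `w ∈ F` certifies `z` as well.
    rw [hz.1, ← hx.2, hx.1.dotProduct_eq hF hw]
    exact le_antisymm ((hsuf x hx.1 hx.2).2 z hz.1) (hz.2 x hx.2)
  · have hS : S A (lam, b) = lassoSol A lam b := by ext; simp [S, hlam, hlam.ne']
    change S A (lam, b) = {z | (lam, b, z) ∈ SF A F}
    rw [hS]
    ext z
    rw [Set.mem_ofPred_eq, mem_SF_iff_of_pos hF hlam (exists_residual_eq hlam b z)]
    constructor
    · intro hz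
      have hy := exists_residual_eq (A := A) hlam b x
      rw [mem_SF_iff_of_pos hF hlam hy] at hx
      have h1 := hz x
      have h2 := lasso_objective_eq hlam hy z
      have h3 := hx.1.dotProduct_eq hF hx.2
      have h4 := mulVec_dotProduct_le (face_subset_Y0 hF hx.2) z
      have hc : 0 < 1 / (2 * lam) := by positivity
      have h5 := mul_nonneg hc.le (sqNorm_nonneg (A *ᵥ z - A *ᵥ x))
      -- `z` is no worse than `x`, and its excess is a nonnegative duality gap plus this square;
      -- both vanish, so all solutions share `A x` and hence `y`.
      have h6 : 1 / (2 * lam) * sqNorm (A *ᵥ z - A *ᵥ x) = 0 := by linarith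
      have h7 := sub_eq_zero.1
        (eq_zero_of_sqNorm ((mul_eq_zero.1 h6).resolve_left hc.ne'))
      have h8 : l1norm z = (A *ᵥ z) ⬝ᵥ (lam⁻¹ • (b - A *ᵥ x)) := by linarith
      rw [h7, h3] at h8
      refine ⟨signCompatible_of_dotProduct_eq hF fun w hw => ?_, by rw [h7]; exact hx.2⟩
      rw [h7, h8, hx.1.dotProduct_eq hF hw]
    · rintro ⟨hz, hy⟩ w
      rw [lasso_objective_eq hlam (exists_residual_eq hlam b z) w]
      have h3 := hz.dotProduct_eq hF hy
      have h4 := mulVec_dotProduct_le (face_subset_Y0 hF hy) w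
      have h5 : 0 ≤ 1 / (2 * lam) * sqNorm (A *ᵥ w - A *ᵥ z) :=
        mul_nonneg (by positivity) (sqNorm_nonneg _)
      linarith

end Face

/-! ### Existence and optimality conditions for the Lasso -/

lemma nonpos_of_forall_mul_le_sq {u C δ : ℝ} (hC : 0 ≤ C) (hδ : 0 < δ)
    (h : ∀ t, 0 < t → t < δ → t * u ≤ C * t ^ 2) : u ≤ 0 := by
  by_contra! hu
  -- For such `t`, `C * t < u`; the `+ 1` keeps the denominator positive when `C = 0`.
  have ht : 0 < min (δ / 2) (u / (2 * (C + 1))) := by positivity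
  have h1 := h _ ht ((min_le_left _ _).trans_lt (by linarith))
  have h2 : min (δ / 2) (u / (2 * (C + 1))) * (2 * (C + 1)) ≤ u :=
    (le_div_iff₀ (by positivity)).1 (min_le_right _ _)
  generalize min (δ / 2) (u / (2 * (C + 1))) = t at *
  have h3 : u ≤ C * t := le_of_mul_le_mul_left (by linarith) ht
  nlinarith

/-- The error `C * t ^ 2` is of second order, so `g` is a subgradient of `|·|` at `a`. When `a ≠ 0`,
steps shorter than `|a|` preserve the sign. -/
lemma abs_subgradient {a g C : ℝ} (hC : 0 ≤ C)
    (h : ∀ t, t * g ≤ |a + t| - |a| + C * t ^ 2) :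
    |g| ≤ 1 ∧ (0 < a → g = 1) ∧ (a < 0 → g = -1) := by
  have h1 : g - 1 ≤ 0 := nonpos_of_forall_mul_le_sq hC one_pos fun t ht _ => by
    have := h t
    have := abs_add_le a t
    rw [abs_of_pos ht] at this
    linarith
  have h2 : -g - 1 ≤ 0 := nonpos_of_forall_mul_le_sq hC one_pos fun t ht _ => by
    have := h (-t)
    have := abs_add_le a (-t)
    rw [abs_neg, abs_of_pos ht] at this
    linarith
  refine ⟨abs_le.2 ⟨by linarith, by linarith⟩, fun ha => ?_, fun ha => ?_⟩
  · have h3 : 1 - g ≤ 0 := nonpos_of_forall_mul_le_sq hC ha fun t ht hta => by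
      have := h (-t)
      rw [abs_of_pos ha, abs_of_pos (by linarith)] at this
      linarith
    linarith
  · have h3 : 1 + g ≤ 0 := nonpos_of_forall_mul_le_sq hC (neg_pos.2 ha) fun t ht hta => by
      have := h t
      rw [abs_of_neg ha, abs_of_neg (by linarith)] at this
      linarith
    linarith

lemma l1norm_add_single (x : Fin n → ℝ) (i : Fin n) (t : ℝ) :
    l1norm (x + Pi.single i t) = l1norm x + (|x i + t| - |x i|) := by
  rw [← sub_eq_iff_eq_add', l1norm, l1norm, ← Finset.sum_sub_distrib, Finset.sum_eq_single i]
  · simp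
  · intro j _ hj
    simp [hj]
  · simp

/-- Varying a single coordinate reduces optimality to the one-variable inequality of
`abs_subgradient`. -/
lemma lassoSol_optimality {lam : ℝ} (hlam : 0 < lam) {b y : Fin m → ℝ} {x : Fin n → ℝ}
    (hx : x ∈ lassoSol A lam b) (hy : b - A *ᵥ x = lam • y) (i : Fin n) :
    |A.col i ⬝ᵥ y| ≤ 1 ∧ (0 < x i → A.col i ⬝ᵥ y = 1) ∧ (x i < 0 → A.col i ⬝ᵥ y = -1) := by
  refine abs_subgradient (C := 1 / (2 * lam) * sqNorm (A.col i))
    (mul_nonneg (by positivity) (sqNorm_nonneg _)) fun t => ?_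
  have h0 := lasso_objective_eq hlam hy (x + Pi.single i t)
  have h1 := hx (x + Pi.single i t)
  rw [h0, l1norm_add_single] at h1
  have h2 : A *ᵥ Pi.single i t = t • A.col i := by
    ext k; simp [mul_comm]
  rw [Matrix.mulVec_add, h2, add_sub_cancel_left, add_dotProduct, smul_dotProduct,
    smul_eq_mul] at h1
  have h3 : sqNorm (t • A.col i) = t ^ 2 * sqNorm (A.col i) := by
    simp only [sqNorm, Pi.smul_apply, smul_eq_mul, mul_pow, Finset.mul_sum]
  rw [h3] at h1
  linarith

lemma norm_le_l1norm (x : Fin n → ℝ) : ‖x‖ ≤ l1norm x := by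
  refine (pi_norm_le_iff_of_nonneg (Finset.sum_nonneg fun _ _ => abs_nonneg _)).2 fun i => ?_
  exact Finset.single_le_sum (f := fun i => |x i|) (fun _ _ => abs_nonneg _) (Finset.mem_univ i)

lemma lassoSol_nonempty {lam : ℝ} (hlam : 0 < lam) (b : Fin m → ℝ) :
    (lassoSol A lam b).Nonempty := by
  have hc : Continuous fun x : Fin n → ℝ =>
      l1norm x + 1 / (2 * lam) * sqNorm (A *ᵥ x - b) := by
    unfold l1norm sqNorm Matrix.mulVec dotProduct
    simp only [Pi.sub_apply]
    fun_prop
  refine hc.exists_forall_le (Filter.tendsto_atTop_mono (fun x => ?_)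
    (tendsto_norm_cocompact_atTop (E := Fin n → ℝ)))
  have : 0 ≤ 1 / (2 * lam) * sqNorm (A *ᵥ x - b) :=
    mul_nonneg (by positivity) (sqNorm_nonneg _)
  linarith [norm_le_l1norm x]

lemma S_eq_lassoSol {lam : ℝ} (hlam : 0 < lam) (b : Fin m → ℝ) :
    S A (lam, b) = lassoSol A lam b := by
  ext; simp [S, hlam, hlam.ne']

/-- Every Lasso solution lies over the smallest face through its dual solution. -/
lemma exists_face_of_mem_S {lam : ℝ} (hlam : 0 < lam) {b y : Fin m → ℝ} {x : Fin n → ℝ}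
    (hx : x ∈ S A (lam, b)) (hy : b - A *ᵥ x = lam • y) :
    ∃ F ∈ faces A, (lam, b, x) ∈ SF A F ∧ activePos A F = {i | A.col i ⬝ᵥ y = 1} ∧
      activeNeg A F = {i | A.col i ⬝ᵥ y = -1} ∧
      activeZero A F = {i | |A.col i ⬝ᵥ y| < 1} := by
  rw [S_eq_lassoSol hlam] at hx
  have hopt := lassoSol_optimality hlam hx hy
  obtain ⟨F, hF, hyF, hp, hn, hz⟩ := exists_minimal_face ((mem_Y0_iff y).2 fun i => (hopt i).1)
  refine ⟨F, hF, (mem_SF_iff_of_pos hF hlam hy).2 ⟨⟨?_, ?_, ?_⟩, hyF⟩, hp, hn, hz⟩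
  · rw [hp]
    intro i (hi : _ = _)
    by_contra! h
    have := (hopt i).2.2 h
    linarith
  · rw [hz]
    intro i (hi : |A.col i ⬝ᵥ y| < 1)
    by_contra h
    rcases lt_or_gt_of_ne h with h | h
    · rw [(hopt i).2.2 h] at hi; norm_num at hi
    · rw [(hopt i).2.1 h] at hi; norm_num at hi
  · rw [hn]
    intro i (hi : _ = _)
    by_contra! h
    have := (hopt i).2.1 h
    linarith

lemma J_eq {lam : ℝ} (hlam : 0 < lam) {b y : Fin m → ℝ} {x : Fin n → ℝ}
    (hy : b - A *ᵥ x = lam • y) :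
    J A lam b x = {i | A.col i ⬝ᵥ y = 1} ∪ {i | A.col i ⬝ᵥ y = -1} := by
  ext i
  rw [Set.mem_union, Set.mem_ofPred_eq, Set.mem_ofPred_eq, J, Set.mem_ofPred_eq, hy,
    dotProduct_smul, smul_eq_mul, abs_mul, abs_of_pos hlam, mul_eq_left₀ hlam.ne',
    abs_eq zero_le_one]

/-! ### Linear independence and linear solutions -/

lemma linearIndepOn_col_iff {I : Set (Fin n)} :
    LinearIndepOn ℝ A.col I ↔ ∀ x : Fin n → ℝ, (∀ i ∉ I, x i = 0) → A *ᵥ x = 0 → x = 0 := by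
  classical
  have hsum : ∀ x : Fin n → ℝ, A *ᵥ x = ∑ i, x i • A.col i := by
    intro x
    ext k
    simp [Matrix.mulVec, dotProduct, mul_comm]
  rw [linearIndepOn_iff']
  constructor
  · intro h x hx hAx
    ext i
    by_cases hi : i ∈ I
    · refine h (Finset.univ.filter (· ∈ I)) x (by simp) ?_ i (by simpa using hi)
      rw [← hAx, hsum, Finset.sum_filter_of_ne]
      intro j _ hj
      by_contra hjI
      exact hj (by rw [hx j hjI, zero_smul])
    · exact hx i hi
  · intro h t g ht hg i hi
    have := congrFun (h (fun j => if j ∈ t then g j else 0)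
      (fun j hj => if_neg fun hjt => hj (ht hjt)) ?_) i
    · simpa [hi] using this
    · rw [hsum]
      simpa [ite_smul] using hg

/-- The equations defining the solution on a face with independent active columns. -/
lemma exists_linear_solution {I : Set (Fin n)} (hI : LinearIndepOn ℝ A.col I) (s : Fin n → ℝ) :
    ∃ L : (ℝ × (Fin m → ℝ)) →ₗ[ℝ] (Fin n → ℝ), ∀ p x,
      ((∀ i ∉ I, x i = 0) ∧ ∀ i ∈ I, A.col i ⬝ᵥ (p.2 - A *ᵥ x) = s i * p.1) ↔ x = L p := by
  classical
  rw [linearIndepOn_col_iff] at hI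
  -- A square system: normal equations on `I`, coordinates off `I`. On its kernel `‖A x‖² = ∑ x i *
  -- (A.col i ⬝ᵥ A x)` vanishes termwise.
  let Φ : (Fin n → ℝ) →ₗ[ℝ] (Fin n → ℝ) :=
    { toFun := fun x i => if i ∈ I then A.col i ⬝ᵥ (A *ᵥ x) else x i
      map_add' := fun x z => by
        ext i
        by_cases hi : i ∈ I <;> simp [hi, Matrix.mulVec_add, dotProduct_add]
      map_smul' := fun c x => by
        ext i
        by_cases hi : i ∈ I <;> simp [hi, Matrix.mulVec_smul, dotProduct_smul] }
  let R : (ℝ × (Fin m → ℝ)) →ₗ[ℝ] (Fin n → ℝ) :=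
    { toFun := fun p i => if i ∈ I then A.col i ⬝ᵥ p.2 - s i * p.1 else 0
      map_add' := fun p q => by
        ext i
        by_cases hi : i ∈ I <;> simp [hi, dotProduct_add]
        ring
      map_smul' := fun c p => by
        ext i
        by_cases hi : i ∈ I <;> simp [hi, dotProduct_smul]
        ring }
  have hΦ : ∀ x i, Φ x i = if i ∈ I then A.col i ⬝ᵥ (A *ᵥ x) else x i := fun _ _ => rfl
  have hR : ∀ p i, R p i = if i ∈ I then A.col i ⬝ᵥ p.2 - s i * p.1 else 0 := fun _ _ => rfl
  have hinj : Function.Injective Φ := by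
    rw [← LinearMap.ker_eq_bot, LinearMap.ker_eq_bot']
    intro x hx
    have h1 : ∀ i ∉ I, x i = 0 := fun i hi => by simpa [hΦ, hi] using congrFun hx i
    have h2 : ∀ i ∈ I, A.col i ⬝ᵥ (A *ᵥ x) = 0 := fun i hi => by
      simpa [hΦ, hi] using congrFun hx i
    refine hI x h1 (dotProduct_self_eq_zero.1 ?_)
    rw [mulVec_dotProduct_eq_sum]
    refine Finset.sum_eq_zero fun i _ => ?_
    by_cases hi : i ∈ I
    · rw [h2 i hi, mul_zero]
    · rw [h1 i hi, zero_mul]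
  let e := LinearEquiv.ofInjectiveEndo Φ hinj
  refine ⟨e.symm.toLinearMap ∘ₗ R, fun p x => ?_⟩
  rw [LinearMap.comp_apply, LinearEquiv.coe_coe, LinearEquiv.eq_symm_apply]
  change _ ↔ Φ x = R p
  rw [funext_iff]
  constructor
  · rintro ⟨h1, h2⟩ i
    by_cases hi : i ∈ I
    · have := h2 i hi
      rw [dotProduct_sub] at this
      rw [hΦ, hR, if_pos hi, if_pos hi]
      linarith
    · rw [hΦ, hR, if_neg hi, if_neg hi, h1 i hi]
  · intro h
    refine ⟨fun i hi => by simpa [hΦ, hR, hi] using h i, fun i hi => ?_⟩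
    have := h i
    rw [hΦ, hR, if_pos hi, if_pos hi] at this
    rw [dotProduct_sub]
    linarith

/-! ### Independent active columns and linearity of `S` on `D_F` -/

section Face

variable {F : Set (Fin m → ℝ)}

lemma mem_DF_iff {lam : ℝ} {b : Fin m → ℝ} : (lam, b) ∈ DF A F ↔ ∃ x, (lam, b, x) ∈ SF A F :=
  ⟨by rintro ⟨⟨lam', b', x⟩, hx, heq⟩; cases heq; exact ⟨x, hx⟩, fun ⟨x, hx⟩ => ⟨_, hx, rfl⟩⟩

lemma not_mem_activeZero {i : Fin n} (hi : i ∈ activePos A F ∪ activeNeg A F) :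
    i ∉ activeZero A F := by
  rintro ⟨y, hy, h1, h2⟩
  rcases hi with hi | hi
  · exact h2.ne (hi y hy)
  · exact h1.ne (hi y hy).symm

lemma mem_activeZero_of_not_mem (hF : F ∈ faces A) {i : Fin n}
    (hi : i ∉ activePos A F ∪ activeNeg A F) : i ∈ activeZero A F := by
  rcases active_trichotomy hF i with h | h | h
  · exact absurd (Or.inl h) hi
  · exact absurd (Or.inr h) hi
  · exact h

/-- The linear solution map of a face with independent active columns. -/
lemma exists_linear_face_solution (hF : F ∈ faces A)
    (hI : LinearIndepOn ℝ A.col (activePos A F ∪ activeNeg A F)) :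
    ∃ L : (ℝ × (Fin m → ℝ)) →ₗ[ℝ] (Fin n → ℝ), ∀ p x,
      ((∀ i ∈ activeZero A F, x i = 0) ∧
        (∀ i ∈ activePos A F, A.col i ⬝ᵥ (p.2 - A *ᵥ x) = p.1) ∧
        ∀ i ∈ activeNeg A F, A.col i ⬝ᵥ (p.2 - A *ᵥ x) = -p.1) ↔ x = L p := by
  obtain ⟨y, hy⟩ := hF.1
  obtain ⟨L, hL⟩ := exists_linear_solution hI fun i => A.col i ⬝ᵥ y
  refine ⟨L, fun p x => ?_⟩
  rw [← hL]
  constructor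
  · rintro ⟨h0, hp, hn⟩
    refine ⟨fun i hi => h0 i (mem_activeZero_of_not_mem hF hi), ?_⟩
    rintro i (hi | hi)
    · rw [hp i hi, hi y hy, one_mul]
    · rw [hn i hi, hi y hy, neg_one_mul]
  · rintro ⟨h0, h1⟩
    refine ⟨fun i hi => h0 i fun h => not_mem_activeZero h hi, fun i hi => ?_, fun i hi => ?_⟩
    · rw [h1 i (Or.inl hi), hi y hy, one_mul]
    · rw [h1 i (Or.inr hi), hi y hy, neg_one_mul]

/-- The equations of `S_F` alone determine `x = L p`; its inequalities only decide which `p` lie in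
`D_F`. -/
lemma singleValuedLinearOn_of_linearIndepOn (hA : A.rank = m) (hF : F ∈ faces A)
    (hI : LinearIndepOn ℝ A.col (activePos A F ∪ activeNeg A F)) :
    SingleValuedLinearOn (S A) (DF A F) := by
  obtain ⟨L, hL⟩ := exists_linear_face_solution hF hI
  refine ⟨L, fun p hp => ?_⟩
  rw [S_eq_slice hA hF hp]
  have hsub : ∀ x, (p.1, p.2, x) ∈ SF A F → x = L p := fun x hx =>
    (hL p x).1 ⟨fun i hi => (hx.2.2.1 i hi).1, fun i hi => (hx.2.1 i hi).2,
      fun i hi => (hx.2.2.2 i hi).2⟩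
  obtain ⟨⟨lam, b, x⟩, hx, rfl⟩ := hp
  refine Set.eq_singleton_iff_unique_mem.2 ⟨?_, hsub⟩
  rw [← hsub x hx]
  exact hx

lemma linearIndepOn_of_singleValuedLinearOn (hA : A.rank = m) (hF : F ∈ faces A) {lam : ℝ}
    (hlam : 0 < lam) {b : Fin m → ℝ} (hp : (lam, b) ∈ DF A F)
    (hS : SingleValuedLinearOn (S A) (DF A F)) :
    LinearIndepOn ℝ A.col (activePos A F ∪ activeNeg A F) := by
  classical
  rw [linearIndepOn_col_iff]
  intro c hc hAc
  obtain ⟨x, hx⟩ := mem_DF_iff.1 hp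
  obtain ⟨L, hL⟩ := hS
  obtain ⟨y, hy⟩ := hF.1
  -- Pushes each active coordinate by `‖c‖` in its allowed direction, leaving room to add `c`.
  -- Replacing `b` by `b + A *ᵥ s` keeps the residual, so uniqueness forces `c = 0`.
  let s : Fin n → ℝ := fun i => if i ∈ activeZero A F then 0 else ‖c‖ * (A.col i ⬝ᵥ y)
  have hs0 : ∀ i ∈ activeZero A F, s i = 0 := fun i hi => if_pos hi
  have hsp : ∀ i ∈ activePos A F, s i = ‖c‖ := fun i hi => by
    simp only [s]
    rw [if_neg (not_mem_activeZero (Or.inl hi)), hi y hy, mul_one]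
  have hsn : ∀ i ∈ activeNeg A F, s i = -‖c‖ := fun i hi => by
    simp only [s]
    rw [if_neg (not_mem_activeZero (Or.inr hi)), hi y hy, mul_neg_one]
  have hci : ∀ i, -‖c‖ ≤ c i ∧ c i ≤ ‖c‖ := fun i => abs_le.1 (norm_le_pi_norm c i)
  have hy0 := exists_residual_eq (A := A) hlam b x
  rw [mem_SF_iff_of_pos hF hlam hy0] at hx
  have key : ∀ z, SignCompatible A F (x + s + z) → A *ᵥ z = 0 →
      (lam, b + A *ᵥ s, x + s + z) ∈ SF A F := by
    intro z hz hAz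
    refine (mem_SF_iff_of_pos hF hlam ?_).2 ⟨hz, hx.2⟩
    rw [← hy0, Matrix.mulVec_add, Matrix.mulVec_add, hAz]
    abel
  have h0 : (lam, b + A *ᵥ s, x + s + 0) ∈ SF A F := by
    refine key 0 ⟨fun i hi => ?_, fun i hi => ?_, fun i hi => ?_⟩ (Matrix.mulVec_zero A)
    · simpa [hsp i hi] using add_nonneg (hx.1.1 i hi) (norm_nonneg c)
    · simp [hs0 i hi, hx.1.2.1 i hi]
    · have := hx.1.2.2 i hi
      have := norm_nonneg c
      simp only [Pi.add_apply, hsn i hi, Pi.zero_apply]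
      linarith
  have h1 : (lam, b + A *ᵥ s, x + s + c) ∈ SF A F := by
    refine key c ⟨fun i hi => ?_, fun i hi => ?_, fun i hi => ?_⟩ hAc
    · have := hx.1.1 i hi
      simp only [Pi.add_apply, hsp i hi]
      linarith [(hci i).1]
    · simp [hs0 i hi, hx.1.2.1 i hi, hc i fun h => not_mem_activeZero h hi]
    · have := hx.1.2.2 i hi
      simp only [Pi.add_apply, hsn i hi]
      linarith [(hci i).2]
  have hD : (lam, b + A *ᵥ s) ∈ DF A F := ⟨_, h0, rfl⟩
  have hset := (S_eq_slice hA hF hD).symm.trans (hL _ hD)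
  have e0 : x + s + 0 ∈ ({L (lam, b + A *ᵥ s)} : Set _) := hset ▸ h0
  have e1 : x + s + c ∈ ({L (lam, b + A *ᵥ s)} : Set _) := hset ▸ h1
  exact (add_left_cancel (e0.trans e1.symm)).symm

/-! ### Interior points -/

/-- The span of the active columns is orthogonal to all differences of points of `F`. -/
lemma dotProduct_eq_of_mem_face (hF : F ∈ faces A) {z : Fin n → ℝ}
    (hz : ∀ i ∈ activeZero A F, z i = 0) {y y' : Fin m → ℝ} (hy : y ∈ F) (hy' : y' ∈ F) :
    (A *ᵥ z) ⬝ᵥ y = (A *ᵥ z) ⬝ᵥ y' := by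
  rw [mulVec_dotProduct_eq_sum, mulVec_dotProduct_eq_sum]
  refine Finset.sum_congr rfl fun i _ => ?_
  rcases active_trichotomy hF i with hi | hi | hi
  · rw [hi y hy, hi y' hy']
  · rw [hi y hy, hi y' hy']
  · rw [hz i hi, zero_mul, zero_mul]

/-- Orthogonal perturbations of the parameters along the face and along the active columns are
resolved separately. -/
lemma orthogonal_perturbation (hF : F ∈ faces A) {lam : ℝ} (hlam : 0 < lam)
    {b y w : Fin m → ℝ} {x v : Fin n → ℝ} (hy : b - A *ᵥ x = lam • y)
    (hx : (lam, b, x) ∈ SF A F) (hv : ∀ i ∈ activeZero A F, v i = 0)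
    (hw : ∀ z : Fin n → ℝ, (∀ i ∈ activeZero A F, z i = 0) → (A *ᵥ z) ⬝ᵥ w = 0)
    (h : (lam, b + lam • w + A *ᵥ v) ∈ DF A F) :
    ∃ x', SignCompatible A F x' ∧ A *ᵥ x' = A *ᵥ (x + v) ∧ y + w ∈ F := by
  rw [mem_SF_iff_of_pos hF hlam hy] at hx
  obtain ⟨x', hx'⟩ := mem_DF_iff.1 h
  have hy' := exists_residual_eq (A := A) hlam (b + lam • w + A *ᵥ v) x'
  rw [mem_SF_iff_of_pos hF hlam hy'] at hx'
  generalize lam⁻¹ • (b + lam • w + A *ᵥ v - A *ᵥ x') = y' at hx' hy'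
  have hr : A *ᵥ (x' - x - v) = lam • (w + y - y') := by
    rw [smul_sub, smul_add, ← hy, ← hy', Matrix.mulVec_sub, Matrix.mulVec_sub]
    abel
  have hz : ∀ i ∈ activeZero A F, (x' - x - v) i = 0 := fun i hi => by
    simp [hx'.1.2.1 i hi, hx.1.2.1 i hi, hv i hi]
  -- This vector lies in the span of the active columns, yet by `hr` it is a multiple of `w + (y -
  -- y')`, which is orthogonal to that span.
  have hr0 : A *ᵥ (x' - x - v) = 0 := by
    refine dotProduct_self_eq_zero.1 ?_
    nth_rewrite 2 [hr]
    rw [dotProduct_smul, dotProduct_sub, dotProduct_add, hw _ hz,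
      dotProduct_eq_of_mem_face hF hz hx.2 hx'.2]
    simp
  refine ⟨x', hx'.1, ?_, ?_⟩
  · rw [Matrix.mulVec_sub, Matrix.mulVec_sub] at hr0
    rw [Matrix.mulVec_add, ← sub_eq_zero, ← hr0]
    abel
  · rw [hr0] at hr
    have := (smul_eq_zero.1 hr.symm).resolve_left hlam.ne'
    rw [add_comm, sub_eq_zero.1 this]
    exact hx'.2

lemma exists_pos_mem_of_mem_interior {D : Set (ℝ × (Fin m → ℝ))} {lam : ℝ} {b : Fin m → ℝ}
    (h : (lam, b) ∈ interior D) (d : Fin m → ℝ) : ∃ t : ℝ, 0 < t ∧ (lam, b + t • d) ∈ D := by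
  have hc : Continuous fun t : ℝ => (lam, b + t • d) := by fun_prop
  have h1 : ∀ᶠ t : ℝ in nhds 0, (lam, b + t • d) ∈ D :=
    hc.continuousAt.eventually_mem (by simpa using mem_interior_iff_mem_nhds.1 h)
  obtain ⟨t, ht, ht0⟩ :=
    ((h1.filter_mono nhdsWithin_le_nhds).and (self_mem_nhdsWithin (s := Set.Ioi 0))).exists
  exact ⟨t, ht0, ht⟩

/-- An interior parameter lets `y` move further away from a point `y₀ ∈ F` strict at `i` without
leaving `Y⁰`, so `y` is strict at `i` too. -/
lemma abs_lt_one_of_mem_interior (hF : F ∈ faces A) {lam : ℝ} (hlam : 0 < lam)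
    {b y : Fin m → ℝ} {x : Fin n → ℝ} (hy : b - A *ᵥ x = lam • y) (hx : (lam, b, x) ∈ SF A F)
    (h : (lam, b) ∈ interior (DF A F)) {i : Fin n} (hi : i ∈ activeZero A F) :
    |A.col i ⬝ᵥ y| < 1 := by
  obtain ⟨y₀, hy₀, h1, h2⟩ := hi
  have hyF := ((mem_SF_iff_of_pos hF hlam hy).1 hx).2
  obtain ⟨t, ht, hD⟩ := exists_pos_mem_of_mem_interior h (lam • (y - y₀))
  obtain ⟨-, -, -, hmem⟩ := orthogonal_perturbation hF hlam (w := t • (y - y₀)) (v := 0) hy hx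
    (fun _ _ => rfl) (fun z hz => by
      rw [dotProduct_smul, dotProduct_sub, dotProduct_eq_of_mem_face hF hz hyF hy₀, sub_self,
        smul_zero])
    (by rw [Matrix.mulVec_zero, add_zero, smul_comm]; exact hD)
  have h3 := (mem_Y0_iff _).1 (face_subset_Y0 hF hmem) i
  rw [dotProduct_add, dotProduct_smul, dotProduct_sub, smul_eq_mul, abs_le] at h3
  rw [abs_lt]
  constructor <;> nlinarith

lemma active_eq_of_mem_interior (hF : F ∈ faces A) {lam : ℝ} (hlam : 0 < lam)
    {b y : Fin m → ℝ} {x : Fin n → ℝ} (hy : b - A *ᵥ x = lam • y) (hx : (lam, b, x) ∈ SF A F)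
    (h : (lam, b) ∈ interior (DF A F)) :
    activePos A F = {i | A.col i ⬝ᵥ y = 1} ∧ activeNeg A F = {i | A.col i ⬝ᵥ y = -1} := by
  have hyF := ((mem_SF_iff_of_pos hF hlam hy).1 hx).2
  constructor
  · ext i
    refine ⟨fun hi => hi y hyF, fun (hi : _ = _) => ?_⟩
    rcases active_trichotomy hF i with h' | h' | h'
    · exact h'
    · have := h' y hyF
      linarith
    · have := abs_lt_one_of_mem_interior hF hlam hy hx h h'
      rw [hi] at this
      norm_num at this
  · ext i
    refine ⟨fun hi => hi y hyF, fun (hi : _ = _) => ?_⟩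
    rcases active_trichotomy hF i with h' | h' | h'
    · have := h' y hyF
      linarith
    · exact h'
    · have := abs_lt_one_of_mem_interior hF hlam hy hx h h'
      rw [hi] at this
      norm_num at this

/-- Both slices equal the solution set, so the two faces share a pair `x`, `y`, and `y` determines
both active sets. -/
lemma face_eq_of_mem_interior (hA : A.rank = m) {F' : Set (Fin m → ℝ)} (hF : F ∈ faces A)
    (hF' : F' ∈ faces A) {lam : ℝ} (hlam : 0 < lam) {b : Fin m → ℝ}
    (h : (lam, b) ∈ interior (DF A F)) (h' : (lam, b) ∈ interior (DF A F')) : F = F' := by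
  have hD := interior_subset h
  have hslice := (S_eq_slice hA hF hD).symm.trans (S_eq_slice hA hF' (interior_subset h'))
  obtain ⟨x, hx⟩ := mem_DF_iff.1 hD
  have hx' : (lam, b, x) ∈ SF A F' := (Set.ext_iff.1 hslice x).1 hx
  have hy := exists_residual_eq (A := A) hlam b x
  obtain ⟨hp, hn⟩ := active_eq_of_mem_interior hF hlam hy hx h
  obtain ⟨hp', hn'⟩ := active_eq_of_mem_interior hF' hlam hy hx' h'
  exact face_eq_of_active_eq hF hF' (hp.trans hp'.symm) (hn.trans hn'.symm)

/-- If `x i = 0`, shift `b` along column `i` against its allowed sign. By independence the new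
solution must follow the shift, and its `i`-th coordinate has the forbidden sign. -/
lemma ne_zero_of_mem_interior (hF : F ∈ faces A) {lam : ℝ} (hlam : 0 < lam) {b : Fin m → ℝ}
    {x : Fin n → ℝ} (hx : (lam, b, x) ∈ SF A F) (h : (lam, b) ∈ interior (DF A F))
    (hI : LinearIndepOn ℝ A.col (activePos A F ∪ activeNeg A F)) {i : Fin n}
    (hi : i ∈ activePos A F ∪ activeNeg A F) : x i ≠ 0 := by
  intro hxi
  obtain ⟨y₀, hy₀⟩ := hF.1
  have hy := exists_residual_eq (A := A) hlam b x
  have hxc := ((mem_SF_iff_of_pos hF hlam hy).1 hx).1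
  have hi0 := not_mem_activeZero hi
  obtain ⟨t, ht, hD⟩ := exists_pos_mem_of_mem_interior h
    (A *ᵥ Pi.single i (-(A.col i ⬝ᵥ y₀)))
  have hv : ∀ j ∈ activeZero A F,
      (t • (Pi.single i (-(A.col i ⬝ᵥ y₀)) : Fin n → ℝ)) j = 0 := by
    intro j hj
    have : j ≠ i := fun e => hi0 (e ▸ hj)
    simp [this]
  obtain ⟨x', hx', hAx', -⟩ := orthogonal_perturbation hF hlam (w := 0)
    (v := t • Pi.single i (-(A.col i ⬝ᵥ y₀))) hy hx hv (fun z _ => dotProduct_zero _)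
    (by rw [smul_zero, add_zero, Matrix.mulVec_smul]; exact hD)
  have hxx := linearIndepOn_col_iff.1 hI (x' - (x + t • Pi.single i (-(A.col i ⬝ᵥ y₀))))
    (fun j hj => by
      have hj0 := mem_activeZero_of_not_mem hF hj
      rw [Pi.sub_apply, Pi.add_apply, hv j hj0, hx'.2.1 j hj0, hxc.2.1 j hj0]
      simp)
    (by rw [Matrix.mulVec_sub, hAx', sub_self])
  have hxi' : x' i = -(t * (A.col i ⬝ᵥ y₀)) := by
    rw [sub_eq_zero.1 hxx]
    simp [hxi]
  rcases hi with hi | hi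
  · have := hx'.1 i hi
    rw [hxi', hi y₀ hy₀] at this
    linarith
  · have := hx'.2.2 i hi
    rw [hxi', hi y₀ hy₀] at this
    linarith

/-- The linear solution `L p` satisfies the equations for every `p`; the inequalities are strict at
`(lam, b)` and survive nearby by continuity. -/
lemma mem_interior_DF (hF : F ∈ faces A) {lam : ℝ} (hlam : 0 < lam) {b : Fin m → ℝ}
    {x : Fin n → ℝ} (hx : (lam, b, x) ∈ SF A F)
    (hI : LinearIndepOn ℝ A.col (activePos A F ∪ activeNeg A F))
    (hne : ∀ i ∈ activePos A F ∪ activeNeg A F, x i ≠ 0)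
    (hstrict : ∀ i ∈ activeZero A F, |A.col i ⬝ᵥ (b - A *ᵥ x)| < lam) :
    (lam, b) ∈ interior (DF A F) := by
  obtain ⟨L, hL⟩ := exists_linear_face_solution hF hI
  have hLc : Continuous L := L.continuous_of_finiteDimensional
  obtain rfl : x = L (lam, b) := (hL (lam, b) x).1 ⟨fun i hi => (hx.2.2.1 i hi).1,
    fun i hi => (hx.2.1 i hi).2, fun i hi => (hx.2.2.2 i hi).2⟩
  have hLi : ∀ i, Continuous fun p => L p i := fun i => (continuous_apply i).comp hLc
  have hpos : ∀ i, ∀ᶠ p in nhds (lam, b), i ∈ activePos A F → 0 ≤ L p i := by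
    intro i
    by_cases hi : i ∈ activePos A F
    · filter_upwards [continuousAt_const.eventually_lt (hLi i).continuousAt
        (lt_of_le_of_ne (hx.2.1 i hi).1 (hne i (Or.inl hi)).symm)] with p hp _ using hp.le
    · exact Filter.Eventually.of_forall fun p h => absurd h hi
  have hneg : ∀ i, ∀ᶠ p in nhds (lam, b), i ∈ activeNeg A F → L p i ≤ 0 := by
    intro i
    by_cases hi : i ∈ activeNeg A F
    · filter_upwards [(hLi i).continuousAt.eventually_lt continuousAt_const
        (lt_of_le_of_ne (hx.2.2.2 i hi).1 (hne i (Or.inr hi)))] with p hp _ using hp.le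
    · exact Filter.Eventually.of_forall fun p h => absurd h hi
  have hzero : ∀ i, ∀ᶠ p in nhds (lam, b), i ∈ activeZero A F →
      |A.col i ⬝ᵥ (p.2 - A *ᵥ L p)| ≤ p.1 := by
    intro i
    by_cases hi : i ∈ activeZero A F
    · have hc : Continuous fun p : ℝ × (Fin m → ℝ) => |A.col i ⬝ᵥ (p.2 - A *ᵥ L p)| :=
        (continuous_const.dotProduct
          (continuous_snd.sub (continuous_const.matrix_mulVec hLc))).abs
      filter_upwards [hc.continuousAt.eventually_lt continuous_fst.continuousAt
        (hstrict i hi)] with p hp _ using hp.le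
    · exact Filter.Eventually.of_forall fun p h => absurd h hi
  have hlamp : ∀ᶠ p in nhds (lam, b), 0 < p.1 :=
    continuousAt_const.eventually_lt continuous_fst.continuousAt hlam
  rw [mem_interior_iff_mem_nhds]
  filter_upwards [hlamp, Filter.eventually_all.2 hpos, Filter.eventually_all.2 hneg,
    Filter.eventually_all.2 hzero] with p h0 h1 h2 h3
  obtain ⟨e0, e1, e2⟩ := (hL p (L p)).2 rfl
  exact ⟨(p.1, p.2, L p), ⟨h0.le, fun i hi => ⟨h1 i hi, e1 i hi⟩,
    fun i hi => ⟨e0 i hi, abs_le.1 (h3 i hi)⟩, fun i hi => ⟨h2 i hi, e2 i hi⟩⟩, rfl⟩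

end Face

/-! ### The two conditions -/

/-- The smallest face through `y` has active set exactly `J`; any other face lying over `(lam, b)`
contains `y`, so its active set is a subset of `J`. -/
theorem forall_singleValued_iff_tibshirani (hA : A.rank = m) {lam : ℝ} (hlam : 0 < lam)
    (b : Fin m → ℝ) :
    (∀ F ∈ faces A, (lam, b) ∈ DF A F → SingleValuedLinearOn (S A) (DF A F)) ↔
      TibshiraniCondition A lam b := by
  constructor
  · intro h
    obtain ⟨x, hx⟩ := lassoSol_nonempty (A := A) hlam b
    rw [← S_eq_lassoSol hlam] at hx
    have hy := exists_residual_eq (A := A) hlam b x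
    obtain ⟨F, hF, hxF, hp, hn, -⟩ := exists_face_of_mem_S hlam hx hy
    have hD : (lam, b) ∈ DF A F := ⟨_, hxF, rfl⟩
    refine ⟨x, hx, ?_⟩
    rw [J_eq hlam hy, ← hp, ← hn]
    exact linearIndepOn_of_singleValuedLinearOn hA hF hlam hD (h F hF hD)
  · rintro ⟨x, hx, hJ⟩ F hF hD
    refine singleValuedLinearOn_of_linearIndepOn hA hF (hJ.mono ?_)
    rw [S_eq_slice hA hF hD] at hx
    have hy := exists_residual_eq (A := A) hlam b x
    have hyF := ((mem_SF_iff_of_pos hF hlam hy).1 hx).2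
    rw [J_eq hlam hy]
    exact Set.union_subset_union (fun i hi => hi _ hyF) (fun i hi => hi _ hyF)

/-- In both directions the active set of `F` coincides with the support of `x`. -/
theorem exists_interior_iff_fuchs (hA : A.rank = m) {lam : ℝ} (hlam : 0 < lam)
    (b : Fin m → ℝ) :
    (∃ F ∈ faces A, (lam, b) ∈ interior (DF A F) ∧ SingleValuedLinearOn (S A) (DF A F)) ↔
      FuchsCondition A lam b := by
  constructor
  · rintro ⟨F, hF, hint, hS⟩
    have hD := interior_subset hint
    have hI := linearIndepOn_of_singleValuedLinearOn hA hF hlam hD hS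
    have hslice := S_eq_slice hA hF hD
    obtain ⟨⟨lam, b, x⟩, hx, heq⟩ := hD
    obtain ⟨rfl, rfl⟩ := Prod.mk.inj heq
    refine ⟨x, hslice ▸ hx, hI.mono ?_, fun i hi => ?_⟩
    · intro i hi
      by_contra hni
      have := (hx.2.2.1 i (mem_activeZero_of_not_mem hF hni)).1
      rcases hi with hi | hi <;> exact hi.ne (by simp_all)
    · have hi0 := mem_activeZero_of_not_mem hF fun h =>
        ne_zero_of_mem_interior hF hlam hx hint hI h hi
      have hy := exists_residual_eq (A := A) hlam b x
      rw [hy, dotProduct_smul, smul_eq_mul, abs_mul, abs_of_pos hlam]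
      exact mul_lt_of_lt_one_right hlam (abs_lt_one_of_mem_interior hF hlam hy hx hint hi0)
  · rintro ⟨x, hx, hI, hstrict⟩
    have hy := exists_residual_eq (A := A) hlam b x
    obtain ⟨F, hF, hxF, hp, hn, hz⟩ := exists_face_of_mem_S hlam hx hy
    have hne : ∀ i ∈ activePos A F ∪ activeNeg A F, x i ≠ 0 := by
      intro i hi hxi
      rw [hp, hn, ← J_eq hlam hy] at hi
      exact (hstrict i hxi).ne hi
    have hI' : LinearIndepOn ℝ A.col (activePos A F ∪ activeNeg A F) :=
      hI.mono fun i hi => (lt_or_gt_of_ne (hne i hi)).symm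
    exact ⟨F, hF, mem_interior_DF hF hlam hxF hI' hne
      fun i hi => hstrict i (hxF.2.2.1 i hi).1,
      singleValuedLinearOn_of_linearIndepOn hA hF hI'⟩

end ExtendedLasso

theorem mainTheorem8 {m n : ℕ} (A : Matrix (Fin m) (Fin n) ℝ) (hA : A.rank = m)
    (lam : ℝ) (hlam : 0 < lam) (b : Fin m → ℝ) :
    ((∀ F ∈ ExtendedLasso.faces A, (lam, b) ∈ ExtendedLasso.DF A F →
        ExtendedLasso.SingleValuedLinearOn (ExtendedLasso.S A) (ExtendedLasso.DF A F)) ↔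
      ExtendedLasso.TibshiraniCondition A lam b) ∧
    (∀ F ∈ ExtendedLasso.faces A, ∀ F' ∈ ExtendedLasso.faces A,
      (lam, b) ∈ interior (ExtendedLasso.DF A F) →
      (lam, b) ∈ interior (ExtendedLasso.DF A F') → F = F') ∧
    ((∃ F ∈ ExtendedLasso.faces A, (lam, b) ∈ interior (ExtendedLasso.DF A F) ∧
        ExtendedLasso.SingleValuedLinearOn (ExtendedLasso.S A) (ExtendedLasso.DF A F)) ↔
      ExtendedLasso.FuchsCondition A lam b) := by
  exact ⟨ExtendedLasso.forall_singleValued_iff_tibshirani hA hlam b,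
    fun _ hF _ hF' h h' => ExtendedLasso.face_eq_of_mem_interior hA hF hF' hlam h h',
    ExtendedLasso.exists_interior_iff_fuchs hA hlam b⟩
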